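/- Let $n\ge 2$. Identify $\mathbb R^3$ with the imaginary quaternions and give $\mathbb H^n=\mathbb R^{4n}$ its Euclidean metric. A polygon with $n$ edges, up to translation, is the list $(e_1,\dots,e_n)$ of its edge vectors in $\mathbb R^3$. Let $\operatorname{Arm}_3(n)$ be the space of (open or closed) polygons of total length $\sum_k|e_k|=2$, and $\operatorname{Arm}_2(n)\subset\operatorname{Arm}_3(n)$ the subspace of those whose edges lie in the plane spanned by $\mathbf i$ and $\mathbf k$. For $d\in\{2,3\}$ let $\operatorname{Pol}_d(n)\subset\operatorname{Arm}_d(n)$ be the subspace of closed polygons, $\sum_k e_k=0$. Let $\operatorname{Hopf}:\mathbb H^n\to(\mathbb R^3)^n$ be the map $(q_1,\dots,q_n)\mapsto(\bar q_1\mathbf i q_1,\dots,\bar q_n\mathbf i q_n)$. The symmetric probability measure on each of these spaces is $$\mu(U)=\frac{\operatorname{Vol}(M\cap\operatorname{Hopf}^{-1}(U))}{\operatorname{Vol}(M)},$$ where $\operatorname{Vol}$ is the Riemannian volume of the submanifold $M\subset\mathbb H^n$ and $M$ is the following model space. - For $\operatorname{Arm}_3(n)$: the sphere $S^{4n-1}$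 of radius $\sqrt2$ in $\mathbb H^n$. - For $\operatorname{Arm}_2(n)$: the disjoint union $S^{2n-1}\sqcup S^{2n-1}$ of the spheres of radius $\sqrt2$ in $(\mathbb R\oplus\mathbb R\mathbf j)^n$ and in $(\mathbb R\mathbf i\oplus\mathbb R\mathbf k)^n$. - For $\operatorname{Pol}_3(n)$: the Stiefel manifold $V_2(\mathbb C^n)$ of Hermitian orthonormal pairs $(u,v)$ in $\mathbb C^n$, embedded in $\mathbb H^n$ by $(u,v)\mapsto u+v\mathbf j$. - For $\operatorname{Pol}_2(n)$: the disjoint union $V_2(\mathbb R^n)\sqcup\mathbf i V_2(\mathbb R^n)$, where $V_2(\mathbb R^n)$ is the set of $u+v\mathbf j$ with $(u,v)$ an orthonormal pair in $\mathbb R^n$. Let $1\le i,j\le n$ with $i\ne j$. Then the inner product $\langle e_i,e_j\rangle$ is integrable with respect to each of the four symmetric measures, and its expected values are $$E(\langle e_i,e_j\rangle,\operatorname{Arm}_3(n))=0,\qquad E(\langle e_i,e_j\rangle,\operatorname{Pol}_3(n))=-\frac{6}{n^3-n},$$ $$E(\langle e_i,e_j\rangle,\operatorname{Arm}_2(n))=0,\qquad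 E(\langle e_i,e_j\rangle,\operatorname{Pol}_2(n))=-\frac{8}{(n-1)n(n+2)}.$$ -/

import Mathlib

open MeasureTheory
open scoped Quaternion MeasureTheory

noncomputable section

namespace PolygonSpace

/-- Three-dimensional Euclidean space; its coordinates `0, 1, 2` are the `i, j, k` components of an
imaginary quaternion. -/
abbrev E3 : Type := EuclideanSpace ℝ (Fin 3)

/-- `ℍⁿ` with its standard Euclidean metric (`ℍⁿ = ℝ⁴ⁿ`). -/
abbrev HSpace (n : ℕ) : Type := PiLp 2 (fun _ : Fin n => ℍ[ℝ])

/-- `ℍⁿ` carries its Borel σ-algebra. -/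
instance instMeasurableSpaceHSpace (n : ℕ) : MeasurableSpace (HSpace n) := borel _

instance instBorelSpaceHSpace (n : ℕ) : BorelSpace (HSpace n) := ⟨rfl⟩

/-- The quaternion unit `i`. -/
def qi : ℍ[ℝ] := ⟨0, 1, 0, 0⟩

/-- The quaternion unit `j`. -/
def qj : ℍ[ℝ] := ⟨0, 0, 1, 0⟩

/-- The imaginary part of a quaternion, as a vector of `ℝ³`. -/
def imVec (p : ℍ[ℝ]) : E3 := !₂[p.imI, p.imJ, p.imK]

/-- The Hopf map `q ↦ q̄ i q`, whose values are purely imaginary quaternions, read in `ℝ³`. -/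
def hopf (q : ℍ[ℝ]) : E3 := imVec (star q * qi * q)

/-- The coordinatewise Hopf map. The vectors `hopf (q 0), …, hopf (q (n - 1))` are the edges of a
polygon. -/
def hopfMap (n : ℕ) (q : HSpace n) : Fin n → E3 := fun k => hopf (q k)

/-! ### Polygon spaces

A polygon with `n` edges, up to translation, is the list of its edge vectors. -/

/-- Space polygons (open or closed) with `n` edges and total length `2`, up to translation. -/
def Arm3 (n : ℕ) : Set (Fin n → E3) := {e | ∑ k, ‖e k‖ = 2}

/-- Plane polygons (open or closed) with `n` edges and total length `2`, up to translation; the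
plane is fixed as the span of `i` and `k` in `ℝ³`. -/
def Arm2 (n : ℕ) : Set (Fin n → E3) := {e | e ∈ Arm3 n ∧ ∀ k, e k 1 = 0}

/-- Closed space polygons with `n` edges and total length `2`, up to translation. -/
def Pol3 (n : ℕ) : Set (Fin n → E3) := {e | e ∈ Arm3 n ∧ ∑ k, e k = 0}

/-- Closed plane polygons with `n` edges and total length `2`, up to translation. -/
def Pol2 (n : ℕ) : Set (Fin n → E3) := {e | e ∈ Arm2 n ∧ ∑ k, e k = 0}

/-! ### Model spaces in `ℍⁿ` -/

/-- The sphere of radius `√2` in `ℍⁿ`, of dimension `4n - 1`. -/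
def quatSphere (n : ℕ) : Set (HSpace n) := Metric.sphere 0 (Real.sqrt 2)

/-- The disjoint union of the spheres of radius `√2` in `(1 ⊕ j)ⁿ` and in `(i ⊕ k)ⁿ`, each of
dimension `2n - 1`. -/
def planarSpheres (n : ℕ) : Set (HSpace n) :=
  {q | q ∈ quatSphere n ∧ ∀ k, (q k).imI = 0 ∧ (q k).imK = 0} ∪
  {q | q ∈ quatSphere n ∧ ∀ k, (q k).re = 0 ∧ (q k).imJ = 0}

/-- The Stiefel manifold `V₂(ℂⁿ)` of Hermitian orthonormal 2-frames `(u, v)` in `ℂⁿ`, embedded in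
`ℍⁿ` by `(u, v) ↦ u + v j`. Its real dimension is `4n - 4`. -/
def complexStiefel (n : ℕ) : Set (HSpace n) :=
  {q | ∃ u v : EuclideanSpace ℂ (Fin n), Orthonormal ℂ ![u, v] ∧
    ∀ k, q k = (u k : ℍ[ℝ]) + (v k : ℍ[ℝ]) * qj}

/-- The Stiefel manifold `V₂(ℝⁿ)` of orthonormal 2-frames `(u, v)` in `ℝⁿ`, embedded in `ℍⁿ` by
`(u, v) ↦ u + v j`. Its dimension is `2n - 3`. -/
def realStiefel (n : ℕ) : Set (HSpace n) :=
  {q | ∃ u v : EuclideanSpace ℝ (Fin n), Orthonormal ℝ ![u, v] ∧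
    ∀ k, q k = (u k : ℍ[ℝ]) + (v k : ℍ[ℝ]) * qj}

/-- The disjoint union of `V₂(ℝⁿ)` and `i V₂(ℝⁿ)` in `ℍⁿ`. -/
def planarStiefel (n : ℕ) : Set (HSpace n) :=
  realStiefel n ∪ {q | ∃ p ∈ realStiefel n, ∀ k, q k = qi * p k}

/-! ### Symmetric measures -/

/-- The normalized `d`-dimensional volume measure of a subset `M` of `ℍⁿ`:
`A ↦ Vol (A ∩ M) / Vol M`. The volume is the `d`-dimensional Hausdorff measure for the Euclidean
distance of `ℍⁿ`; on a `d`-dimensional submanifold it is, up to a constant factor that cancels in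
the quotient, the volume of the Riemannian metric induced from `ℍⁿ`. -/
def normalizedVol {n : ℕ} (d : ℝ) (M : Set (HSpace n)) : Measure (HSpace n) :=
  ProbabilityTheory.cond (Measure.hausdorffMeasure d) M

/-- The measure `U ↦ Vol (M ∩ Hopf⁻¹ U) / Vol M` on a space `X` of polygons. -/
def symMeasure {n : ℕ} (d : ℝ) (M : Set (HSpace n)) (X : Set (Fin n → E3)) : Measure X :=
  ((normalizedVol d M).map (hopfMap n)).comap Subtype.val

/-- The symmetric measure on `Arm3 n`, from the sphere `S⁴ⁿ⁻¹`. -/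
def symArm3 (n : ℕ) : Measure (Arm3 n) := symMeasure (4 * n - 1) (quatSphere n) (Arm3 n)

/-- The symmetric measure on `Arm2 n`, from the two spheres `S²ⁿ⁻¹`. -/
def symArm2 (n : ℕ) : Measure (Arm2 n) := symMeasure (2 * n - 1) (planarSpheres n) (Arm2 n)

/-- The symmetric measure on `Pol3 n`, from the Stiefel manifold `V₂(ℂⁿ)`. -/
def symPol3 (n : ℕ) : Measure (Pol3 n) := symMeasure (4 * n - 4) (complexStiefel n) (Pol3 n)

/-- The symmetric measure on `Pol2 n`, from the two Stiefel manifolds `V₂(ℝⁿ)` and `i V₂(ℝⁿ)`. -/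
def symPol2 (n : ℕ) : Measure (Pol2 n) := symMeasure (2 * n - 3) (planarStiefel n) (Pol2 n)

/-- The inner product `⟨e_i, e_j⟩` of two edges of a polygon, as a function on a space `X` of
polygons. -/
def edgeInner {n : ℕ} (X : Set (Fin n → E3)) (i j : Fin n) (P : X) : ℝ :=
  inner ℝ (P.1 i) (P.1 j)

end PolygonSpace

end

/-! Each symmetric measure lifts to normalized Hausdorff measure on a model space `M` in `ℍⁿ`, so
every isometry of `ℍⁿ` that preserves `M` preserves the measure. The expectations follow from such
symmetries; no integral is computed explicitly.

Arms: multiplying the `j`-th coordinate on the left by the unit `j` preserves `M` and reverses `e_j`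
alone, so the expectation equals its own negative. This holds whatever the total mass.

Closed polygons: let `X = E‖q i‖⁴`, `Y = E(‖q i‖²‖q j‖²)`, `R = E⟪q i, q j⟫²`, `R' = E⟪q i, qi * q
j⟫²` and `G = E⟪e_i, e_j⟫`. Permutation symmetry and total length 2 give `X + (n - 1) Y = 4 / n`.
Pairing `e_i` with `∑ e_k = 0` gives `X + (n - 1) G = 0`. Rotating the coordinates `i`, `j` by 45
degrees (with a reflection) gives `X = Y + 2R`. The identity `inner_hopf` gives `G = 2R + 2R' - Y`.
Finally `R' = R` in space, since `q j` may be replaced by `qi * q j`, and `R' = 0` in the plane,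
where these vectors are orthogonal. The linear system determines `G`.

The first relation needs total mass one, so the Stiefel manifolds must have positive finite
Hausdorff measure in their dimension. They are regular level sets of the Gram map, and the implicit
function theorem compares them locally with the kernel of its derivative. -/

namespace HasStrictFDerivAt

/-! ### Hausdorff measure of regular level sets -/

open Filter Topology Measure Module

variable {E F : Type*} [NormedAddCommGroup E] [NormedSpace ℝ E] [FiniteDimensional ℝ E]
  [MeasurableSpace E] [BorelSpace E]
  [NormedAddCommGroup F] [NormedSpace ℝ F] [FiniteDimensional ℝ F]
  {f : E → F} {f' : E →L[ℝ] F} {a : E}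

/-- The level set through a regular point has positive Hausdorff measure in its dimension. -/
theorem hausdorffMeasure_levelSet_pos (hf : HasStrictFDerivAt f f' a) (hf' : f'.range = ⊤) :
    0 < μH[(finrank ℝ f'.ker : ℝ)] (f ⁻¹' {f a}) := by
  have := FiniteDimensional.complete ℝ E
  have := FiniteDimensional.complete ℝ f'.ker
  obtain ⟨P, hP⟩ := f'.ker_closedComplemented_of_finiteDimensional_range
  set g := hf.implicitFunction f f' hf' (f a) with hg
  have hmap : ∀ᶠ z in 𝓝 (0 : f'.ker), f (g z) = f a :=
    (Continuous.prodMk_right (f a)).continuousAt.eventually (hf.map_implicitFunction_eq hf')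
  -- The projection `P` onto the kernel undoes the parametrization `g` to first order, so the
  -- inverse function theorem makes the projected level set a neighbourhood in the kernel. `P` is
  -- Lipschitz, so a null level set would have a null projection.
  have hder : HasStrictFDerivAt (fun z => P (g z))
      ((ContinuousLinearEquiv.refl ℝ f'.ker : f'.ker ≃L[ℝ] f'.ker) : f'.ker →L[ℝ] f'.ker) 0 := by
    have h := P.hasStrictFDerivAt.comp 0 (hf.to_implicitFunction hf')
    have heq : P ∘L f'.ker.subtypeL = ContinuousLinearMap.id ℝ f'.ker := by
      ext z
      simp [hP]
    rwa [heq] at h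
  have hnhds : P '' (f ⁻¹' {f a}) ∈ 𝓝 (P (g 0)) := by
    rw [← hder.map_nhds_eq_of_equiv, mem_map]
    filter_upwards [hmap] with z hz
    exact ⟨g z, hz, rfl⟩
  have hpos : 0 < μH[(finrank ℝ f'.ker : ℝ)] (P '' (f ⁻¹' {f a})) :=
    measure_pos_of_mem_nhds _ hnhds
  rw [pos_iff_ne_zero] at hpos ⊢
  intro h0
  refine hpos (le_antisymm ?_ bot_le)
  refine (P.lipschitz.hausdorffMeasure_image_le (Nat.cast_nonneg _) _).trans ?_
  simp [h0]

/-- The Hausdorff measure of the level set is finite near a regular point. -/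
theorem finiteAtFilter_hausdorffMeasure_levelSet (hf : HasStrictFDerivAt f f' a)
    (hf' : f'.range = ⊤) :
    (μH[(finrank ℝ f'.ker : ℝ)] : Measure E).FiniteAtFilter (𝓝[f ⁻¹' {f a}] a) := by
  have := FiniteDimensional.complete ℝ E
  have := FiniteDimensional.complete ℝ f'.ker
  set g := hf.implicitFunction f f' hf' (f a) with hg
  set φ := hf.implicitToOpenPartialHomeomorph f f' hf' with hφ
  obtain ⟨K, s, hs, hK⟩ := (hf.to_implicitFunction hf').exists_lipschitzOnWith
  -- The unit ball bounds the parameter set, so that its Lipschitz image has finite measure.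
  set t := s ∩ Metric.ball (0 : f'.ker) 1
  have ht : t ∈ 𝓝 (0 : f'.ker) := inter_mem hs (Metric.ball_mem_nhds _ one_pos)
  have htend : Tendsto (fun x => (φ x).2) (𝓝 a) (𝓝 0) := by
    have h := φ.continuousAt (hf.mem_implicitToOpenPartialHomeomorph_source hf')
    have h2 := (continuous_snd.tendsto (φ a)).comp h
    rwa [hφ, hf.implicitToOpenPartialHomeomorph_self hf'] at h2
  refine ⟨g '' t, ?_, ?_⟩
  · rw [mem_nhdsWithin_iff_eventually]
    filter_upwards [htend ht, hf.eq_implicitFunction hf'] with x hx hx' hxa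
    rw [Set.mem_preimage, Set.mem_singleton_iff] at hxa
    rw [hxa] at hx'
    exact ⟨_, hx, hx'⟩
  · refine ((hK.mono Set.inter_subset_left).hausdorffMeasure_image_le
      (Nat.cast_nonneg _)).trans_lt ?_
    refine ENNReal.mul_lt_top (by simp) ?_
    exact (measure_mono Set.inter_subset_right).trans_lt Metric.isBounded_ball.measure_lt_top

end HasStrictFDerivAt

noncomputable section

namespace StiefelVolume

/-! ### Orthonormal pairs as a regular level set of the Gram map -/

open Module Measure

variable (𝕜 : Type*) [RCLike 𝕜] (n : ℕ)

/-- Pairs of vectors of `𝕜ⁿ`. -/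
abbrev Pairs : Type _ := EuclideanSpace 𝕜 (Fin n) × EuclideanSpace 𝕜 (Fin n)

/-- Orthonormal pairs of vectors of `𝕜ⁿ`. -/
def frames : Set (Pairs 𝕜 n) := {p | Orthonormal 𝕜 ![p.1, p.2]}

/-- The entries of the Gram matrix of a pair of vectors. -/
def gram (p : Pairs 𝕜 n) : ℝ × ℝ × 𝕜 :=
  (RCLike.re (inner 𝕜 p.1 p.1), RCLike.re (inner 𝕜 p.2 p.2), inner 𝕜 p.1 p.2)

variable {𝕜 n}

theorem orthonormal_pair_iff {V : Type*} [NormedAddCommGroup V] [InnerProductSpace 𝕜 V]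
    (u v : V) : Orthonormal 𝕜 ![u, v] ↔ ‖u‖ = 1 ∧ ‖v‖ = 1 ∧ inner 𝕜 u v = 0 := by
  constructor
  · intro h
    exact ⟨h.1 0, h.1 1, h.2 (by decide : (0 : Fin 2) ≠ 1)⟩
  · rintro ⟨h1, h2, h3⟩
    refine ⟨by simp [Fin.forall_fin_two, h1, h2], ?_⟩
    intro a b hab
    fin_cases a <;> fin_cases b <;> simp_all [inner_eq_zero_symm]

theorem mem_frames_iff (p : Pairs 𝕜 n) : p ∈ frames 𝕜 n ↔ gram 𝕜 n p = (1, 1, 0) := by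
  simp only [frames, Set.mem_ofPred_eq, orthonormal_pair_iff, gram, Prod.mk.injEq,
    inner_self_eq_norm_sq]
  simp [pow_eq_one_iff_of_nonneg]

theorem continuous_gram : Continuous (gram 𝕜 n) := by
  unfold gram
  exact ((RCLike.continuous_re.comp (continuous_fst.inner continuous_fst)).prodMk
    ((RCLike.continuous_re.comp (continuous_snd.inner continuous_snd)).prodMk
      (continuous_fst.inner continuous_snd)))

theorem frames_eq_preimage : frames 𝕜 n = gram 𝕜 n ⁻¹' {(1, 1, 0)} := by
  ext p
  simp [mem_frames_iff]

theorem finiteDimensional_euclideanSpace : FiniteDimensional ℝ (EuclideanSpace 𝕜 (Fin n)) :=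
  FiniteDimensional.trans ℝ 𝕜 _

attribute [local instance] finiteDimensional_euclideanSpace

theorem isCompact_frames : IsCompact (frames 𝕜 n) := by
  have : ProperSpace (Pairs 𝕜 n) := FiniteDimensional.proper ℝ _
  refine Metric.isCompact_of_isClosed_isBounded ?_ ?_
  · rw [frames_eq_preimage]
    exact isClosed_singleton.preimage continuous_gram
  · refine (Metric.isBounded_iff_subset_closedBall 0).2 ⟨1, fun p hp => ?_⟩
    obtain ⟨h1, h2, -⟩ := (orthonormal_pair_iff _ _).1 hp
    rw [mem_closedBall_zero_iff, Prod.norm_def, h1, h2, max_self]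

/-- The derivative of `gram`. -/
def gramDeriv (p : Pairs 𝕜 n) : Pairs 𝕜 n →L[ℝ] ℝ × ℝ × 𝕜 :=
  (RCLike.reCLM ∘L (fderivInnerCLM 𝕜 (p.1, p.1) ∘L
      ((ContinuousLinearMap.fst ℝ _ _).prod (ContinuousLinearMap.fst ℝ _ _)))).prod
    ((RCLike.reCLM ∘L (fderivInnerCLM 𝕜 (p.2, p.2) ∘L
      ((ContinuousLinearMap.snd ℝ _ _).prod (ContinuousLinearMap.snd ℝ _ _)))).prod
    (fderivInnerCLM 𝕜 (p.1, p.2) ∘L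
      ((ContinuousLinearMap.fst ℝ _ _).prod (ContinuousLinearMap.snd ℝ _ _))))

theorem hasStrictFDerivAt_gram (p : Pairs 𝕜 n) :
    HasStrictFDerivAt (gram 𝕜 n) (gramDeriv p) p := by
  have h1 : HasStrictFDerivAt (Prod.fst : Pairs 𝕜 n → _) (ContinuousLinearMap.fst ℝ _ _) p :=
    hasStrictFDerivAt_fst
  have h2 : HasStrictFDerivAt (Prod.snd : Pairs 𝕜 n → _) (ContinuousLinearMap.snd ℝ _ _) p :=
    hasStrictFDerivAt_snd
  exact (RCLike.reCLM.hasStrictFDerivAt.comp p (h1.inner 𝕜 h1)).prodMk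
    ((RCLike.reCLM.hasStrictFDerivAt.comp p (h2.inner 𝕜 h2)).prodMk (h1.inner 𝕜 h2))

theorem range_gramDeriv {p : Pairs 𝕜 n} (hp : p ∈ frames 𝕜 n) : (gramDeriv p).range = ⊤ := by
  obtain ⟨h1, h2, h3⟩ := (orthonormal_pair_iff _ _).1 hp
  have h4 : inner 𝕜 p.2 p.1 = 0 := inner_eq_zero_symm.1 h3
  rw [LinearMap.range_eq_top]
  rintro ⟨s, t, z⟩
  -- Differentiating a squared norm produces a factor 2, hence the halves. Adding `z • p.1` to the
  -- second vector changes the mixed entry by `z` and, by orthogonality, leaves the diagonal entries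
  -- alone.
  obtain ⟨a, rfl⟩ : ∃ a, s = a + a := ⟨s / 2, by ring⟩
  obtain ⟨b, rfl⟩ : ∃ b, t = b + b := ⟨t / 2, by ring⟩
  refine ⟨((a : 𝕜) • p.1, (b : 𝕜) • p.2 + z • p.1), ?_⟩
  simp [gramDeriv, inner_smul_left, inner_smul_right, inner_add_right, inner_add_left, h1, h2, h3,
    h4, inner_self_eq_norm_sq_to_K, inner_smul_left_eq_smul,
    inner_smul_right_eq_smul, RCLike.smul_re]

theorem finrank_ker_gramDeriv {p : Pairs 𝕜 n} (hp : p ∈ frames 𝕜 n) :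
    (finrank ℝ (gramDeriv p).ker : ℝ) = 2 * n * finrank ℝ 𝕜 - 2 - finrank ℝ 𝕜 := by
  have h := (gramDeriv p : Pairs 𝕜 n →ₗ[ℝ] ℝ × ℝ × 𝕜).finrank_range_add_finrank_ker
  rw [range_gramDeriv hp, finrank_top] at h
  have hE : finrank ℝ (EuclideanSpace 𝕜 (Fin n)) = finrank ℝ 𝕜 * n := by
    rw [← finrank_mul_finrank ℝ 𝕜 (EuclideanSpace 𝕜 (Fin n)), finrank_euclideanSpace_fin]
  simp only [finrank_prod, finrank_self, hE] at h
  have h' : ((1 + (1 + finrank ℝ 𝕜) + finrank ℝ (gramDeriv p).ker : ℕ) : ℝ) =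
    ((finrank ℝ 𝕜 * n + finrank ℝ 𝕜 * n : ℕ) : ℝ) := congrArg _ h
  push_cast at h'
  linarith

theorem frames_nonempty {i j : Fin n} (hij : i ≠ j) : (frames 𝕜 n).Nonempty :=
  ⟨(EuclideanSpace.single i 1, EuclideanSpace.single j 1),
    (orthonormal_pair_iff _ _).2 (by simp [EuclideanSpace.inner_single_left, hij])⟩

variable [MeasurableSpace (Pairs 𝕜 n)] [BorelSpace (Pairs 𝕜 n)]

theorem hausdorffMeasure_frames_pos {i j : Fin n} (hij : i ≠ j) :
    0 < μH[2 * n * finrank ℝ 𝕜 - 2 - finrank ℝ 𝕜] (frames 𝕜 n) := by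
  obtain ⟨p, hp⟩ := frames_nonempty (𝕜 := 𝕜) hij
  have h := (hasStrictFDerivAt_gram p).hausdorffMeasure_levelSet_pos (range_gramDeriv hp)
  rwa [finrank_ker_gramDeriv hp, (mem_frames_iff p).1 hp, ← frames_eq_preimage] at h

/-- Compactness turns finiteness near each point into finiteness of the total. -/
theorem hausdorffMeasure_frames_lt_top :
    μH[2 * n * finrank ℝ 𝕜 - 2 - finrank ℝ 𝕜] (frames 𝕜 n) < ⊤ := by
  refine isCompact_frames.measure_lt_top_of_nhdsWithin fun p hp => ?_
  have h := (hasStrictFDerivAt_gram p).finiteAtFilter_hausdorffMeasure_levelSet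
    (range_gramDeriv hp)
  rwa [finrank_ker_gramDeriv hp, (mem_frames_iff p).1 hp, ← frames_eq_preimage] at h

end StiefelVolume

end

noncomputable section

namespace PolygonSpace

open Module Measure StiefelVolume

/-! ### Coordinates of the Hopf map -/

/-- The quaternion with given coordinates. -/
def quat (a b c d : ℝ) : ℍ[ℝ] := ⟨a, b, c, d⟩

@[simp] theorem quat_re (a b c d : ℝ) : (quat a b c d).re = a := rfl

@[simp] theorem quat_imI (a b c d : ℝ) : (quat a b c d).imI = b := rfl

@[simp] theorem quat_imJ (a b c d : ℝ) : (quat a b c d).imJ = c := rfl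

@[simp] theorem quat_imK (a b c d : ℝ) : (quat a b c d).imK = d := rfl

@[simp] theorem qi_re : qi.re = 0 := rfl

@[simp] theorem qi_imI : qi.imI = 1 := rfl

@[simp] theorem qi_imJ : qi.imJ = 0 := rfl

@[simp] theorem qi_imK : qi.imK = 0 := rfl

@[simp] theorem qj_re : qj.re = 0 := rfl

@[simp] theorem qj_imI : qj.imI = 0 := rfl

@[simp] theorem qj_imJ : qj.imJ = 1 := rfl

@[simp] theorem qj_imK : qj.imK = 0 := rfl

theorem hopf_apply_zero (q : ℍ[ℝ]) :
    hopf q 0 = q.re ^ 2 + q.imI ^ 2 - q.imJ ^ 2 - q.imK ^ 2 := by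
  simp [hopf, imVec]; ring

theorem hopf_apply_one (q : ℍ[ℝ]) : hopf q 1 = 2 * (q.imI * q.imJ - q.re * q.imK) := by
  simp [hopf, imVec]; ring

theorem hopf_apply_two (q : ℍ[ℝ]) : hopf q 2 = 2 * (q.re * q.imJ + q.imI * q.imK) := by
  simp [hopf, imVec]; ring

theorem norm_sq_eq (q : ℍ[ℝ]) : ‖q‖ ^ 2 = q.re ^ 2 + q.imI ^ 2 + q.imJ ^ 2 + q.imK ^ 2 := by
  rw [pow_two, ← Quaternion.normSq_eq_norm_mul_self, Quaternion.normSq_def']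

theorem E3_ext {x y : E3} (h0 : x 0 = y 0) (h1 : x 1 = y 1) (h2 : x 2 = y 2) : x = y := by
  ext l
  fin_cases l
  exacts [h0, h1, h2]

theorem norm_hopf (q : ℍ[ℝ]) : ‖hopf q‖ = ‖q‖ ^ 2 := by
  rw [EuclideanSpace.norm_eq, Real.sqrt_eq_iff_eq_sq (by positivity) (by positivity)]
  simp only [Fin.sum_univ_three, hopf_apply_zero, hopf_apply_one, hopf_apply_two, norm_sq_eq,
    Real.norm_eq_abs, sq_abs]
  ring

/-- The double-angle formula `2 cos² θ - 1`: for nonzero arguments, `θ` is the angle between `p` and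
the plane spanned by the orthogonal vectors `q` and `qi * q`, which have equal norms. -/
theorem inner_hopf (p q : ℍ[ℝ]) : inner ℝ (hopf p) (hopf q) =
    2 * (inner ℝ p q ^ 2 + inner ℝ p (qi * q) ^ 2) - ‖p‖ ^ 2 * ‖q‖ ^ 2 := by
  simp only [PiLp.inner_apply, Fin.sum_univ_three, hopf_apply_zero, hopf_apply_one,
    hopf_apply_two, norm_sq_eq, Quaternion.inner_def]
  simp
  ring

theorem hopf_qi_mul (q : ℍ[ℝ]) : hopf (qi * q) = hopf q := by
  apply E3_ext <;> simp only [hopf_apply_zero, hopf_apply_one, hopf_apply_two] <;>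
    simp <;> ring

/-- Conjugation by the unit `j` sends `i` to `-i`. -/
theorem hopf_qj_mul (q : ℍ[ℝ]) : hopf (qj * q) = -hopf q := by
  apply E3_ext <;>
    simp only [PiLp.neg_apply, hopf_apply_zero, hopf_apply_one, hopf_apply_two] <;>
    simp <;> ring

theorem norm_qi : ‖qi‖ = 1 := by
  rw [← sq_eq_sq₀ (norm_nonneg _) zero_le_one, norm_sq_eq]; simp

theorem norm_qj : ‖qj‖ = 1 := by
  rw [← sq_eq_sq₀ (norm_nonneg _) zero_le_one, norm_sq_eq]; simp

theorem continuous_hopf : Continuous hopf := by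
  have h0 := Quaternion.continuous_re
  have h1 := Quaternion.continuous_imI
  have h2 := Quaternion.continuous_imJ
  have h3 := Quaternion.continuous_imK
  have h : ∀ l, Continuous fun q => hopf q l := by
    intro l
    fin_cases l
    · simp only [Fin.zero_eta, hopf_apply_zero]; fun_prop
    · simp only [Fin.mk_one, hopf_apply_one]; fun_prop
    · simp only [Fin.reduceFinMk, hopf_apply_two]; fun_prop
  exact (PiLp.continuous_toLp 2 _).comp (continuous_pi h)

theorem continuous_hopfMap (n : ℕ) : Continuous (hopfMap n) :=
  continuous_pi fun k => continuous_hopf.comp (PiLp.continuous_apply 2 _ k)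

/-! ### The Stiefel manifolds -/

/-- The polygon is closed and has total length `2`. -/
def IsClosedPreimage {n : ℕ} (q : HSpace n) : Prop := ∑ k, ‖q k‖ ^ 2 = 2 ∧ ∑ k, hopf (q k) = 0

theorem mem_quatSphere_iff {n : ℕ} (q : HSpace n) : q ∈ quatSphere n ↔ ∑ k, ‖q k‖ ^ 2 = 2 := by
  rw [quatSphere, mem_sphere_zero_iff_norm, ← sq_eq_sq₀ (norm_nonneg _) (Real.sqrt_nonneg _),
    Real.sq_sqrt zero_le_two, PiLp.norm_sq_eq_of_L2]

variable (𝕜 : Type*) [RCLike 𝕜] (n : ℕ)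

/-- The embedding `(u, v) ↦ u + v j`. -/
def pairsToHSpace : Pairs 𝕜 n →ₗ[ℝ] HSpace n where
  toFun p := WithLp.toLp 2 fun k =>
    quat (RCLike.re (p.1 k)) (RCLike.im (p.1 k)) (RCLike.re (p.2 k)) (RCLike.im (p.2 k))
  map_add' p q := by ext k <;> simp
  map_smul' c p := by ext k <;> simp [RCLike.smul_re, RCLike.smul_im]

/-- A left inverse of `pairsToHSpace`. -/
def hSpaceToPairs : HSpace n →ₗ[ℝ] Pairs 𝕜 n where
  toFun q := (WithLp.toLp 2 fun k => ((q k).re : 𝕜) + (q k).imI * RCLike.I,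
    WithLp.toLp 2 fun k => ((q k).imJ : 𝕜) + (q k).imK * RCLike.I)
  map_add' p q := by
    ext k <;> simp <;> ring
  map_smul' c p := by
    ext k <;> simp [RCLike.real_smul_eq_coe_mul] <;> ring

variable {𝕜 n}

theorem hSpaceToPairs_pairsToHSpace (p : Pairs 𝕜 n) :
    hSpaceToPairs 𝕜 n (pairsToHSpace 𝕜 n p) = p := by
  ext k <;> simp [hSpaceToPairs, pairsToHSpace, RCLike.re_add_im]

/-- The sum of the Hopf vectors has first coordinate `‖u‖² - ‖v‖²`, and its other two are, up to
sign, twice the imaginary and real parts of the inner product of `u` and `v`. Length 2 says `‖u‖² +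
‖v‖² = 2`. Together these are the Gram equations. -/
theorem isClosedPreimage_pairsToHSpace_iff (p : Pairs 𝕜 n) :
    IsClosedPreimage (pairsToHSpace 𝕜 n p) ↔ p ∈ frames 𝕜 n := by
  rw [mem_frames_iff, gram, Prod.mk.injEq, Prod.mk.injEq, RCLike.ext_iff (K := 𝕜),
    IsClosedPreimage]
  have key : ∀ x : E3, x = 0 ↔ x 0 = 0 ∧ x 1 = 0 ∧ x 2 = 0 := fun x =>
    ⟨by rintro rfl; simp, fun h => E3_ext h.1 h.2.1 h.2.2⟩
  rw [key]
  simp only [PiLp.inner_apply, WithLp.ofLp_sum, Finset.sum_apply, hopf_apply_zero, hopf_apply_one,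
    hopf_apply_two, norm_sq_eq, pairsToHSpace, LinearMap.coe_mk, AddHom.coe_mk, _root_.map_sum,
    quat_re, quat_imI, quat_imJ, quat_imK]
  simp only [RCLike.inner_apply, RCLike.mul_re, RCLike.mul_im, RCLike.conj_re, RCLike.conj_im,
    map_zero, ← Finset.mul_sum, Finset.sum_add_distrib, Finset.sum_sub_distrib, mul_neg, neg_mul,
    sub_neg_eq_add, pow_two, Finset.sum_neg_distrib, mul_comm (RCLike.re (p.2 _)),
    mul_comm (RCLike.im (p.2 _))]
  constructor
  · rintro ⟨h1, h2, h3, h4⟩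
    refine ⟨?_, ?_, ?_, ?_⟩ <;> linarith
  · rintro ⟨h1, h2, h3, h4⟩
    refine ⟨?_, ?_, ?_, ?_⟩ <;> linarith

theorem complexStiefel_eq_image : complexStiefel n = pairsToHSpace ℂ n '' frames ℂ n := by
  ext q
  constructor
  · rintro ⟨u, v, huv, h⟩
    refine ⟨(u, v), huv, ?_⟩
    ext k <;> simp [h k, pairsToHSpace]
  · rintro ⟨⟨u, v⟩, huv, rfl⟩
    refine ⟨u, v, huv, fun k => ?_⟩
    ext <;> simp [pairsToHSpace]

theorem realStiefel_eq_image : realStiefel n = pairsToHSpace ℝ n '' frames ℝ n := by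
  ext q
  constructor
  · rintro ⟨u, v, huv, h⟩
    refine ⟨(u, v), huv, ?_⟩
    ext k <;> simp [h k, pairsToHSpace]
  · rintro ⟨⟨u, v⟩, huv, rfl⟩
    refine ⟨u, v, huv, fun k => ?_⟩
    ext <;> simp [pairsToHSpace]

theorem mem_complexStiefel_iff (q : HSpace n) : q ∈ complexStiefel n ↔ IsClosedPreimage q := by
  rw [complexStiefel_eq_image]
  have h : pairsToHSpace ℂ n (hSpaceToPairs ℂ n q) = q := by
    ext k <;> simp [pairsToHSpace, hSpaceToPairs]
  constructor
  · rintro ⟨p, hp, rfl⟩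
    exact (isClosedPreimage_pairsToHSpace_iff p).2 hp
  · intro hq
    exact ⟨_, (isClosedPreimage_pairsToHSpace_iff _).1 (by rwa [h]), h⟩

theorem mem_realStiefel_iff (q : HSpace n) : q ∈ realStiefel n ↔
    IsClosedPreimage q ∧ ∀ k, (q k).imI = 0 ∧ (q k).imK = 0 := by
  rw [realStiefel_eq_image]
  constructor
  · rintro ⟨p, hp, rfl⟩
    exact ⟨(isClosedPreimage_pairsToHSpace_iff p).2 hp, by simp [pairsToHSpace]⟩
  · rintro ⟨hq, h0⟩
    have h : pairsToHSpace ℝ n (hSpaceToPairs ℝ n q) = q := by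
      ext k <;> simp [pairsToHSpace, hSpaceToPairs, h0]
    exact ⟨_, (isClosedPreimage_pairsToHSpace_iff _).1 (by rwa [h]), h⟩

/-- All coordinates lie in `ℝ ⊕ ℝj`, or all lie in `ℝi ⊕ ℝk`. -/
def IsPlanar (q : HSpace n) : Prop :=
  (∀ k, (q k).imI = 0 ∧ (q k).imK = 0) ∨ ∀ k, (q k).re = 0 ∧ (q k).imJ = 0

theorem mem_planarSpheres_iff (q : HSpace n) :
    q ∈ planarSpheres n ↔ ∑ k, ‖q k‖ ^ 2 = 2 ∧ IsPlanar q := by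
  simp only [planarSpheres, Set.mem_union, Set.mem_ofPred_eq, mem_quatSphere_iff, IsPlanar]
  tauto

theorem mem_planarStiefel_iff (q : HSpace n) :
    q ∈ planarStiefel n ↔ IsClosedPreimage q ∧ IsPlanar q := by
  have h : (∃ p ∈ realStiefel n, ∀ k, q k = qi * p k) ↔
      IsClosedPreimage q ∧ ∀ k, (q k).re = 0 ∧ (q k).imJ = 0 := by
    constructor
    · rintro ⟨p, hp, hq⟩
      obtain ⟨⟨h1, h2⟩, h3⟩ := (mem_realStiefel_iff p).1 hp
      refine ⟨⟨?_, ?_⟩, fun k => ?_⟩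
      · simpa [hq, norm_qi] using h1
      · simpa [hq, hopf_qi_mul] using h2
      · simp [hq, h3 k]
    · rintro ⟨⟨h1, h2⟩, h3⟩
      -- Left multiplication by `-i` inverts left multiplication by `i`, and the sign is invisible
      -- to the Hopf map.
      have hii : ∀ x : ℍ[ℝ], x = qi * -(qi * x) := fun x => by ext <;> simp
      have hneg : ∀ x, hopf (-x) = hopf x := fun x => by
        apply E3_ext <;> simp [hopf_apply_zero, hopf_apply_one, hopf_apply_two]
      refine ⟨WithLp.toLp 2 fun k => -(qi * q k), (mem_realStiefel_iff _).2 ⟨⟨?_, ?_⟩, ?_⟩,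
        fun k => hii _⟩
      · simpa [norm_qi] using h1
      · simpa [hneg, hopf_qi_mul] using h2
      · intro k
        simp [h3 k]
  rw [planarStiefel, Set.mem_union, mem_realStiefel_iff, Set.mem_ofPred_eq, h, IsPlanar]
  tauto

end PolygonSpace

end

noncomputable section

namespace PolygonSpace

open Module Measure StiefelVolume

/-! ### Volumes of the Stiefel manifolds in `ℍⁿ` -/

variable {𝕜 : Type*} [RCLike 𝕜] {n : ℕ}

instance : FiniteDimensional ℝ (HSpace n) :=
  inferInstanceAs (FiniteDimensional ℝ (PiLp 2 (fun _ : Fin n => ℍ[ℝ])))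

/-- `Pairs` carries the supremum metric, not the Euclidean one. The embedding and its left inverse
are both Lipschitz, which suffices to transfer positivity and finiteness. -/
theorem hausdorffMeasure_image_frames {i j : Fin n} (hij : i ≠ j) :
    μH[2 * n * finrank ℝ 𝕜 - 2 - finrank ℝ 𝕜] (pairsToHSpace 𝕜 n '' frames 𝕜 n) ≠ 0 ∧
    μH[2 * n * finrank ℝ 𝕜 - 2 - finrank ℝ 𝕜] (pairsToHSpace 𝕜 n '' frames 𝕜 n) ≠ ⊤ := by
  let : MeasurableSpace (Pairs 𝕜 n) := borel _
  have : BorelSpace (Pairs 𝕜 n) := ⟨rfl⟩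
  have := finiteDimensional_euclideanSpace (𝕜 := 𝕜) (n := n)
  have hd : (0 : ℝ) ≤ 2 * n * finrank ℝ 𝕜 - 2 - finrank ℝ 𝕜 := by
    obtain ⟨p, hp⟩ := frames_nonempty (𝕜 := 𝕜) hij
    rw [← finrank_ker_gramDeriv hp]
    positivity
  constructor
  · intro h0
    refine (hausdorffMeasure_frames_pos (𝕜 := 𝕜) hij).ne' (le_antisymm ?_ bot_le)
    have h := (hSpaceToPairs 𝕜 n).toContinuousLinearMap.lipschitz.hausdorffMeasure_image_le hd
      (pairsToHSpace 𝕜 n '' frames 𝕜 n)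
    have hs : (hSpaceToPairs 𝕜 n).toContinuousLinearMap '' (pairsToHSpace 𝕜 n '' frames 𝕜 n) =
        frames 𝕜 n := by
      rw [← Set.image_comp]
      exact (Set.image_congr fun p _ => hSpaceToPairs_pairsToHSpace p).trans (Set.image_id _)
    rwa [h0, mul_zero, hs] at h
  · refine (((pairsToHSpace 𝕜 n).toContinuousLinearMap.lipschitz.hausdorffMeasure_image_le hd
      (frames 𝕜 n)).trans_lt (ENNReal.mul_lt_top ?_ hausdorffMeasure_frames_lt_top)).ne
    exact ENNReal.rpow_lt_top_of_nonneg hd ENNReal.coe_ne_top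

theorem hausdorffMeasure_complexStiefel {i j : Fin n} (hij : i ≠ j) :
    μH[4 * n - 4] (complexStiefel n) ≠ 0 ∧ μH[4 * n - 4] (complexStiefel n) ≠ ⊤ := by
  have h := hausdorffMeasure_image_frames (𝕜 := ℂ) hij
  rw [Complex.finrank_real_complex, ← complexStiefel_eq_image] at h
  convert h using 4 <;> norm_num <;> ring

theorem hausdorffMeasure_realStiefel {i j : Fin n} (hij : i ≠ j) :
    μH[2 * n - 3] (realStiefel n) ≠ 0 ∧ μH[2 * n - 3] (realStiefel n) ≠ ⊤ := by
  have h := hausdorffMeasure_image_frames (𝕜 := ℝ) hij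
  rw [finrank_self, ← realStiefel_eq_image] at h
  convert h using 4 <;> norm_num <;> ring

theorem hausdorffMeasure_planarStiefel {i j : Fin n} (hij : i ≠ j) :
    μH[2 * n - 3] (planarStiefel n) ≠ 0 ∧ μH[2 * n - 3] (planarStiefel n) ≠ ⊤ := by
  obtain ⟨h0, htop⟩ := hausdorffMeasure_realStiefel hij
  have hn : (2 : ℝ) ≤ n := by
    have : Nontrivial (Fin n) := ⟨i, j, hij⟩
    exact_mod_cast Fin.nontrivial_iff_two_le.1 this
  have hd : (0 : ℝ) ≤ 2 * n - 3 := by linarith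
  let L : HSpace n →ₗ[ℝ] HSpace n :=
    { toFun := fun p => WithLp.toLp 2 fun k => qi * p k
      map_add' := fun p q => by ext k : 1; simp [mul_add]
      map_smul' := fun a q => by ext k : 1; simp }
  have hL : {q : HSpace n | ∃ p ∈ realStiefel n, ∀ k, q k = qi * p k} =
      L.toContinuousLinearMap '' realStiefel n := by
    ext q
    constructor
    · rintro ⟨p, hp, hq⟩
      exact ⟨p, hp, by ext k : 1; exact (hq k).symm⟩
    · rintro ⟨p, hp, rfl⟩
      exact ⟨p, hp, fun k => rfl⟩
  constructor
  · exact fun h => h0 (measure_mono_null Set.subset_union_left h)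
  · rw [planarStiefel, hL]
    refine ((measure_union_le _ _).trans_lt (ENNReal.add_lt_top.2 ⟨htop.lt_top, ?_⟩)).ne
    exact (L.toContinuousLinearMap.lipschitz.hausdorffMeasure_image_le hd _).trans_lt
      (ENNReal.mul_lt_top (ENNReal.rpow_lt_top_of_nonneg hd ENNReal.coe_ne_top) htop.lt_top)

/-! ### Isometries of `ℍⁿ` -/

theorem norm_sq_eq_sum (q : HSpace n) : ‖q‖ ^ 2 = ∑ k, ‖q k‖ ^ 2 := PiLp.norm_sq_eq_of_L2 _ q

/-- A linear endomorphism preserving the norm, as an isometry. -/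
def isometryOfNorm (T : HSpace n →ₗ[ℝ] HSpace n) (hT : ∀ q, ∑ k, ‖T q k‖ ^ 2 = ∑ k, ‖q k‖ ^ 2) :
    HSpace n ≃ᵢ HSpace n :=
  (LinearIsometry.toLinearIsometryEquiv ⟨T, fun q => by
    rw [← sq_eq_sq₀ (norm_nonneg _) (norm_nonneg _), norm_sq_eq_sum, norm_sq_eq_sum, hT]⟩
      rfl).toIsometryEquiv

/-- Left multiplication of each coordinate by a unit quaternion. -/
def leftMul (c : Fin n → ℍ[ℝ]) (hc : ∀ k, ‖c k‖ = 1) : HSpace n ≃ᵢ HSpace n :=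
  isometryOfNorm
    { toFun := fun q => WithLp.toLp 2 fun k => c k * q k
      map_add' := fun p q => by ext k : 1; simp [mul_add]
      map_smul' := fun a q => by ext k : 1; simp }
    fun q => by simp [hc]

@[simp]
theorem leftMul_apply (c : Fin n → ℍ[ℝ]) (hc : ∀ k, ‖c k‖ = 1) (q : HSpace n) (k : Fin n) :
    leftMul c hc q k = c k * q k := rfl

/-- Permutation of the coordinates. -/
def permCoord (σ : Equiv.Perm (Fin n)) : HSpace n ≃ᵢ HSpace n :=
  isometryOfNorm
    { toFun := fun q => WithLp.toLp 2 fun k => q (σ k)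
      map_add' := fun p q => by ext k : 1; simp
      map_smul' := fun a q => by ext k : 1; simp }
    fun q => Equiv.sum_comp σ fun k => ‖q k‖ ^ 2

@[simp]
theorem permCoord_apply (σ : Equiv.Perm (Fin n)) (q : HSpace n) (k : Fin n) :
    permCoord σ q k = q (σ k) := rfl

/-- The coordinates of the reflection `(x, y) ↦ ((x + y) / √2, (x - y) / √2)` in the plane of the
coordinates `i` and `j`. -/
def reflectCoord (i j : Fin n) (q : HSpace n) (k : Fin n) : ℍ[ℝ] :=
  if k = i then (√2)⁻¹ • (q i + q j) else if k = j then (√2)⁻¹ • (q i - q j) else q k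

/-- Only two coordinates change, so the two-variable identity `hf` is enough. It is used for the
quadratic maps `‖x‖ ^ 2` and `hopf`, where it is the parallelogram law. -/
theorem sum_reflectCoord {V : Type*} [AddCommGroup V] (f : ℍ[ℝ] → V) {i j : Fin n} (hij : i ≠ j)
    (hf : ∀ x y, f ((√2)⁻¹ • (x + y)) + f ((√2)⁻¹ • (x - y)) = f x + f y) (q : HSpace n) :
    ∑ k, f (reflectCoord i j q k) = ∑ k, f (q k) := by
  rw [← sub_eq_zero, ← Finset.sum_sub_distrib, Fintype.sum_eq_add i j hij]
  · simp only [reflectCoord, if_true, if_neg hij.symm]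
    rw [sub_add_sub_comm, hf, sub_self]
  · rintro k ⟨hi, hj⟩
    simp [reflectCoord, hi, hj]

theorem inv_sqrt_two_sq : ((√2)⁻¹ : ℝ) ^ 2 = 1 / 2 := by
  rw [inv_pow, Real.sq_sqrt zero_le_two, one_div]

theorem norm_sq_smul_add (x y : ℍ[ℝ]) :
    ‖(√2)⁻¹ • (x + y)‖ ^ 2 = (‖x‖ ^ 2 + ‖y‖ ^ 2) / 2 + inner ℝ x y := by
  rw [norm_smul, mul_pow, Real.norm_eq_abs, sq_abs, inv_sqrt_two_sq, norm_add_sq_real]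
  ring

theorem norm_sq_smul_sub (x y : ℍ[ℝ]) :
    ‖(√2)⁻¹ • (x - y)‖ ^ 2 = (‖x‖ ^ 2 + ‖y‖ ^ 2) / 2 - inner ℝ x y := by
  rw [norm_smul, mul_pow, Real.norm_eq_abs, sq_abs, inv_sqrt_two_sq, norm_sub_sq_real]
  ring

theorem hopf_smul_add_add_hopf_smul_sub (x y : ℍ[ℝ]) :
    hopf ((√2)⁻¹ • (x + y)) + hopf ((√2)⁻¹ • (x - y)) = hopf x + hopf y := by
  have h := inv_sqrt_two_sq
  set s := (√2)⁻¹
  apply E3_ext <;>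
    simp only [PiLp.add_apply, hopf_apply_zero, hopf_apply_one, hopf_apply_two] <;>
    simp
  · linear_combination 2 * (x.re ^ 2 + x.imI ^ 2 - x.imJ ^ 2 - x.imK ^ 2 +
      (y.re ^ 2 + y.imI ^ 2 - y.imJ ^ 2 - y.imK ^ 2)) * h
  · linear_combination 4 * (x.imI * x.imJ - x.re * x.imK + (y.imI * y.imJ - y.re * y.imK)) * h
  · linear_combination 4 * (x.re * x.imJ + x.imI * x.imK + (y.re * y.imJ + y.imI * y.imK)) * h

/-- The reflection `(x, y) ↦ ((x + y) / √2, (x - y) / √2)` in the coordinates `i` and `j`. -/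
def reflect {i j : Fin n} (hij : i ≠ j) : HSpace n ≃ᵢ HSpace n :=
  isometryOfNorm
    { toFun := fun q => WithLp.toLp 2 (reflectCoord i j q)
      map_add' := fun p q => by
        ext k : 1
        simp only [reflectCoord, PiLp.add_apply]
        split_ifs <;> module
      map_smul' := fun a q => by
        ext k : 1
        simp only [reflectCoord, PiLp.smul_apply, RingHom.id_apply]
        split_ifs <;> module }
    fun q => sum_reflectCoord (fun x => ‖x‖ ^ 2) hij
      (fun x y => by rw [norm_sq_smul_add, norm_sq_smul_sub]; ring) q

theorem reflect_apply {i j : Fin n} (hij : i ≠ j) (q : HSpace n) (k : Fin n) :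
    reflect hij q k = reflectCoord i j q k := rfl

/-! ### Invariance of the model spaces -/

theorem isClosedPreimage_permCoord_iff (σ : Equiv.Perm (Fin n)) (q : HSpace n) :
    IsClosedPreimage (permCoord σ q) ↔ IsClosedPreimage q := by
  simp only [IsClosedPreimage, permCoord_apply]
  rw [Equiv.sum_comp σ fun k => ‖q k‖ ^ 2, Equiv.sum_comp σ fun k => hopf (q k)]

theorem isPlanar_permCoord_iff (σ : Equiv.Perm (Fin n)) (q : HSpace n) :
    IsPlanar (permCoord σ q) ↔ IsPlanar q := by
  simp only [IsPlanar, permCoord_apply]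
  rw [σ.forall_congr_right (q := fun k => (q k).imI = 0 ∧ (q k).imK = 0),
    σ.forall_congr_right (q := fun k => (q k).re = 0 ∧ (q k).imJ = 0)]

theorem isClosedPreimage_reflect_iff {i j : Fin n} (hij : i ≠ j) (q : HSpace n) :
    IsClosedPreimage (reflect hij q) ↔ IsClosedPreimage q := by
  simp only [IsClosedPreimage, reflect_apply]
  rw [sum_reflectCoord hopf hij hopf_smul_add_add_hopf_smul_sub]
  rw [sum_reflectCoord (fun x => ‖x‖ ^ 2) hij
    (fun x y => by rw [norm_sq_smul_add, norm_sq_smul_sub]; ring)]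

/-- The reflection mixes coordinates by an invertible real matrix, so it preserves the vanishing of
each real component. `L` stands for one of the four components. -/
theorem forall_reflect_iff {i j : Fin n} (hij : i ≠ j) (L : ℍ[ℝ] → ℝ)
    (hadd : ∀ (s : ℝ) x y, L (s • (x + y)) = s * (L x + L y))
    (hsub : ∀ (s : ℝ) x y, L (s • (x - y)) = s * (L x - L y)) (q : HSpace n) :
    (∀ k, L (reflect hij q k) = 0) ↔ ∀ k, L (q k) = 0 := by
  have hs : ((√2)⁻¹ : ℝ) ≠ 0 := by positivity
  constructor
  · intro h
    have hi := h i
    have hj := h j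
    simp only [reflect_apply, reflectCoord, if_true, if_neg hij.symm, hadd, hsub, mul_eq_zero, hs, false_or] at hi hj
    intro k
    by_cases hki : k = i
    · subst hki; linarith
    by_cases hkj : k = j
    · subst hkj; linarith
    simpa [reflect_apply, reflectCoord, hki, hkj] using h k
  · intro h k
    simp only [reflect_apply, reflectCoord]
    split_ifs <;> simp only [h, hadd, hsub] <;> ring

theorem isPlanar_reflect_iff {i j : Fin n} (hij : i ≠ j) (q : HSpace n) :
    IsPlanar (reflect hij q) ↔ IsPlanar q := by
  have hre := forall_reflect_iff hij (fun x => x.re) (by simp [mul_add]) (by simp [mul_sub]) q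
  have hI := forall_reflect_iff hij (fun x => x.imI) (by simp [mul_add]) (by simp [mul_sub]) q
  have hJ := forall_reflect_iff hij (fun x => x.imJ) (by simp [mul_add]) (by simp [mul_sub]) q
  have hK := forall_reflect_iff hij (fun x => x.imK) (by simp [mul_add]) (by simp [mul_sub]) q
  simp only [IsPlanar, forall_and, hre, hI, hJ, hK]

/-- The tuple equal to `x` at `j` and to `1` elsewhere. -/
def unitAt (j : Fin n) (x : ℍ[ℝ]) (k : Fin n) : ℍ[ℝ] := if k = j then x else 1

theorem norm_unitAt {x : ℍ[ℝ]} (hx : ‖x‖ = 1) (j k : Fin n) : ‖unitAt j x k‖ = 1 := by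
  unfold unitAt; split_ifs <;> simp [hx]

theorem isClosedPreimage_leftMul_qi_iff (j : Fin n) (q : HSpace n) :
    IsClosedPreimage (leftMul (unitAt j qi) (norm_unitAt norm_qi j) q) ↔ IsClosedPreimage q := by
  have h : ∀ k, hopf (unitAt j qi k * q k) = hopf (q k) := by
    intro k
    unfold unitAt
    split_ifs
    · rw [hopf_qi_mul]
    · rw [one_mul]
  simp [IsClosedPreimage, norm_unitAt norm_qi, h]

/-- Left multiplication by the unit `j` maps each of `ℝ ⊕ ℝj` and `ℝi ⊕ ℝk` onto itself, so acting
on one coordinate alone cannot break planarity. -/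
theorem isPlanar_leftMul_qj_iff (j : Fin n) (q : HSpace n) :
    IsPlanar (leftMul (unitAt j qj) (norm_unitAt norm_qj j) q) ↔ IsPlanar q := by
  unfold IsPlanar
  refine or_congr (forall_congr' fun k => ?_) (forall_congr' fun k => ?_) <;>
  · rw [leftMul_apply, unitAt]
    split_ifs
    · simp [and_comm]
    · rw [one_mul]

end PolygonSpace

end

noncomputable section

namespace PolygonSpace

open Module Measure StiefelVolume

variable {n : ℕ}

/-! ### Measurability -/

theorem isCompact_quatSphere : IsCompact (quatSphere n) := by
  have : ProperSpace (HSpace n) := FiniteDimensional.proper ℝ _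
  exact isCompact_sphere _ _

theorem continuous_coord (k : Fin n) : Continuous fun q : HSpace n => q k :=
  PiLp.continuous_apply 2 _ k

theorem isClosed_isPlanar : IsClosed {q : HSpace n | IsPlanar q} := by
  simp only [IsPlanar, Set.ofPred_or, Set.ofPred_forall, Set.ofPred_and]
  refine IsClosed.union (isClosed_iInter fun k => ?_) (isClosed_iInter fun k => ?_)
  · exact (isClosed_eq (Quaternion.continuous_imI.comp (continuous_coord k)) continuous_const).inter
      (isClosed_eq (Quaternion.continuous_imK.comp (continuous_coord k)) continuous_const)
  · exact (isClosed_eq (Quaternion.continuous_re.comp (continuous_coord k)) continuous_const).inter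
      (isClosed_eq (Quaternion.continuous_imJ.comp (continuous_coord k)) continuous_const)

theorem measurableSet_quatSphere : MeasurableSet (quatSphere n) :=
  isCompact_quatSphere.isClosed.measurableSet

theorem measurableSet_planarSpheres : MeasurableSet (planarSpheres n) := by
  have h : planarSpheres n = quatSphere n ∩ {q | IsPlanar q} := by
    ext q
    rw [mem_planarSpheres_iff, ← mem_quatSphere_iff]
    rfl
  rw [h]
  exact measurableSet_quatSphere.inter isClosed_isPlanar.measurableSet

theorem measurableSet_complexStiefel : MeasurableSet (complexStiefel n) := by
  have h : complexStiefel n = quatSphere n ∩ {q | ∑ k, hopf (q k) = 0} := by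
    ext q
    rw [mem_complexStiefel_iff, IsClosedPreimage, ← mem_quatSphere_iff]
    rfl
  rw [h]
  refine measurableSet_quatSphere.inter (isClosed_eq ?_ continuous_const).measurableSet
  exact continuous_finsetSum _ fun k _ => continuous_hopf.comp (continuous_coord k)

theorem measurableSet_planarStiefel : MeasurableSet (planarStiefel n) := by
  have h : planarStiefel n = complexStiefel n ∩ {q | IsPlanar q} := by
    ext q
    rw [mem_planarStiefel_iff, ← mem_complexStiefel_iff]
    rfl
  rw [h]
  exact measurableSet_complexStiefel.inter isClosed_isPlanar.measurableSet

theorem continuous_edge_coord (k : Fin n) (l : Fin 3) :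
    Continuous fun e : Fin n → E3 => e k l :=
  (PiLp.continuous_apply 2 _ l).comp (continuous_apply k)

theorem isClosed_Arm3 : IsClosed (Arm3 n) :=
  isClosed_eq (continuous_finsetSum _ fun k _ => (continuous_apply k).norm) continuous_const

theorem isClosed_Arm2 : IsClosed (Arm2 n) := by
  have h : Arm2 n = Arm3 n ∩ ⋂ k, {e | e k 1 = 0} := by
    ext e
    simp [Arm2]
  rw [h]
  exact isClosed_Arm3.inter
    (isClosed_iInter fun k => isClosed_eq (continuous_edge_coord k 1) continuous_const)

theorem isClosed_sum_eq_zero : IsClosed {e : Fin n → E3 | ∑ k, e k = 0} :=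
  isClosed_eq (continuous_finsetSum _ fun k _ => continuous_apply k) continuous_const

theorem measurableSet_Arm3 : MeasurableSet (Arm3 n) := isClosed_Arm3.measurableSet

theorem measurableSet_Arm2 : MeasurableSet (Arm2 n) := isClosed_Arm2.measurableSet

theorem measurableSet_Pol3 : MeasurableSet (Pol3 n) :=
  (isClosed_Arm3.inter isClosed_sum_eq_zero).measurableSet

theorem measurableSet_Pol2 : MeasurableSet (Pol2 n) :=
  (isClosed_Arm2.inter isClosed_sum_eq_zero).measurableSet

/-! ### The Hopf map sends model spaces to polygon spaces -/

theorem hopfMap_mem_Arm3 {q : HSpace n} (hq : ∑ k, ‖q k‖ ^ 2 = 2) : hopfMap n q ∈ Arm3 n := by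
  simpa [Arm3, hopfMap, norm_hopf] using hq

theorem hopfMap_mem_Arm2 {q : HSpace n} (hq : ∑ k, ‖q k‖ ^ 2 = 2) (hp : IsPlanar q) :
    hopfMap n q ∈ Arm2 n := by
  refine ⟨hopfMap_mem_Arm3 hq, fun k => ?_⟩
  rw [hopfMap, hopf_apply_one]
  rcases hp with h | h <;> simp [h k]

/-! ### Integrals against the symmetric measures -/

/-- The inner product of two edges, as a function on `ℍⁿ`. -/
def edgeInnerLift (i j : Fin n) (q : HSpace n) : ℝ := inner ℝ (hopf (q i)) (hopf (q j))

theorem continuous_edgeInnerLift (i j : Fin n) : Continuous (edgeInnerLift i j) :=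
  (continuous_hopf.comp (continuous_coord i)).inner (continuous_hopf.comp (continuous_coord j))

theorem integrable_of_continuous {ν : Measure (HSpace n)} [IsFiniteMeasure ν]
    (hν : ∀ᵐ q ∂ν, ∑ k, ‖q k‖ ^ 2 = 2) {g : HSpace n → ℝ} (hg : Continuous g) :
    Integrable g ν := by
  have h : IntegrableOn g (quatSphere n) ν :=
    hg.continuousOn.integrableOn_compact isCompact_quatSphere
  rwa [IntegrableOn, Measure.restrict_eq_self_of_ae_mem] at h
  filter_upwards [hν] with q hq
  exact (mem_quatSphere_iff q).2 hq

section SymMeasure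

variable {d : ℝ} {M : Set (HSpace n)} {X : Set (Fin n → E3)}

theorem ae_normalizedVol (hM : MeasurableSet M) : ∀ᵐ q ∂normalizedVol d M, q ∈ M :=
  ProbabilityTheory.ae_cond_mem hM

theorem isFiniteMeasure_normalizedVol : IsFiniteMeasure (normalizedVol d M) := by
  unfold normalizedVol; infer_instance

/-- The pushforward is concentrated on `X`, so pulling it back to the subtype loses no mass.
Integrability holds because `M` lies in a compact sphere. -/
theorem integrable_integral_symMeasure (hM : MeasurableSet M) (hX : MeasurableSet X)
    (hMX : ∀ q ∈ M, ∑ k, ‖q k‖ ^ 2 = 2 ∧ hopfMap n q ∈ X) (i j : Fin n) :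
    Integrable (edgeInner X i j) (symMeasure d M X) ∧
      ∫ P, edgeInner X i j P ∂symMeasure d M X =
        ∫ q, edgeInnerLift i j q ∂normalizedVol d M := by
  have := isFiniteMeasure_normalizedVol (d := d) (M := M)
  have hmeas : Measurable (hopfMap n) := (continuous_hopfMap n).measurable
  have hrestr : ((normalizedVol d M).map (hopfMap n)).restrict X =
      (normalizedVol d M).map (hopfMap n) := by
    refine Measure.restrict_eq_self_of_ae_mem ?_
    refine (ae_map_iff hmeas.aemeasurable hX).2 ?_
    filter_upwards [ae_normalizedVol hM] with q hq using (hMX q hq).2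
  let g : (Fin n → E3) → ℝ := fun e => inner ℝ (e i) (e j)
  have hg : Continuous g := (continuous_apply i).inner (continuous_apply j)
  have hint : Integrable (edgeInnerLift i j) (normalizedVol d M) :=
    integrable_of_continuous ((ae_normalizedVol hM).mono fun q hq => (hMX q hq).1)
      (continuous_edgeInnerLift i j)
  constructor
  · have h := (integrable_map_measure hg.aestronglyMeasurable hmeas.aemeasurable).2 hint
    rw [← hrestr] at h
    exact (integrableOn_iff_comap_subtypeVal hX).1 h
  · have h := integral_subtype_comap (μ := (normalizedVol d M).map (hopfMap n)) hX g
    rw [hrestr, integral_map hmeas.aemeasurable hg.aestronglyMeasurable] at h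
    exact h

theorem measurePreserving_normalizedVol (T : HSpace n ≃ᵢ HSpace n) (hM : MeasurableSet M)
    (hT : ∀ q, T q ∈ M ↔ q ∈ M) :
    MeasurePreserving T (normalizedVol d M) (normalizedVol d M) := by
  have h := (T.measurePreserving_hausdorffMeasure d).restrict_preimage hM
  have hpre : T ⁻¹' M = M := Set.ext hT
  rw [hpre] at h
  exact h.smul_measure _

end SymMeasure

theorem integral_comp_isometry {ν : Measure (HSpace n)} {T : HSpace n ≃ᵢ HSpace n}
    (hT : MeasurePreserving T ν ν) (g : HSpace n → ℝ) : ∫ q, g (T q) ∂ν = ∫ q, g q ∂ν :=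
  hT.integral_comp T.toHomeomorph.measurableEmbedding g

/-! ### Arms -/

theorem integral_edgeInnerLift_eq_zero {ν : Measure (HSpace n)} {i j : Fin n} (hij : i ≠ j)
    (hT : MeasurePreserving (leftMul (unitAt j qj) (norm_unitAt norm_qj j)) ν ν) :
    ∫ q, edgeInnerLift i j q ∂ν = 0 := by
  have h := integral_comp_isometry hT (edgeInnerLift i j)
  have hneg : ∀ q, edgeInnerLift i j (leftMul (unitAt j qj) (norm_unitAt norm_qj j) q) =
      -edgeInnerLift i j q := by
    intro q
    simp [edgeInnerLift, unitAt, hij, hopf_qj_mul, inner_neg_right]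
  simp only [hneg, integral_neg] at h
  linarith

/-! ### Moments of a random closed polygon -/

section Moments

variable {ν : Measure (HSpace n)} {i j : Fin n}

theorem integral_edgeInnerLift [IsFiniteMeasure ν] (hν : ∀ᵐ q ∂ν, ∑ k, ‖q k‖ ^ 2 = 2) :
    ∫ q, edgeInnerLift i j q ∂ν =
      2 * ∫ q, inner ℝ (q i) (q j) ^ 2 ∂ν + 2 * ∫ q, inner ℝ (q i) (qi * q j) ^ 2 ∂ν -
        ∫ q, ‖q i‖ ^ 2 * ‖q j‖ ^ 2 ∂ν := by
  have ci := continuous_coord i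
  have cj := continuous_coord j
  have I1 : Integrable (fun q : HSpace n => 2 * inner ℝ (q i) (q j) ^ 2) ν :=
    integrable_of_continuous hν (by fun_prop)
  have I2 : Integrable (fun q : HSpace n => 2 * inner ℝ (q i) (qi * q j) ^ 2) ν :=
    integrable_of_continuous hν (by fun_prop)
  have I3 : Integrable (fun q : HSpace n => ‖q i‖ ^ 2 * ‖q j‖ ^ 2) ν :=
    integrable_of_continuous hν (by fun_prop)
  rw [← integral_const_mul, ← integral_const_mul, ← integral_add I1 I2,
    ← integral_sub (I1.fun_add I2) I3]
  refine integral_congr_ae (.of_forall fun q => ?_)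
  simp only [edgeInnerLift, inner_hopf]
  ring

theorem integral_swap_coord
    (hperm : ∀ σ : Equiv.Perm (Fin n), MeasurePreserving (permCoord σ) ν ν)
    (hij : i ≠ j) {k : Fin n} (hk : k ≠ i) (g : ℍ[ℝ] → ℍ[ℝ] → ℝ) :
    ∫ q, g (q i) (q k) ∂ν = ∫ q, g (q i) (q j) ∂ν := by
  have h := integral_comp_isometry (hperm (Equiv.swap j k)) fun q => g (q i) (q j)
  simpa [Equiv.swap_apply_of_ne_of_ne hij hk.symm] using h

theorem integral_coord
    (hperm : ∀ σ : Equiv.Perm (Fin n), MeasurePreserving (permCoord σ) ν ν)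
    (i k : Fin n) (g : ℍ[ℝ] → ℝ) :
    ∫ q, g (q k) ∂ν = ∫ q, g (q i) ∂ν := by
  have h := integral_comp_isometry (hperm (Equiv.swap i k)) fun q => g (q i)
  simpa using h

/-- By permutation symmetry the `n - 1` terms with `k ≠ i` are equal. This converts a constraint on
`∑ k` into a relation between two moments. -/
theorem sum_integral_coord
    (hperm : ∀ σ : Equiv.Perm (Fin n), MeasurePreserving (permCoord σ) ν ν)
    (hij : i ≠ j) (g : ℍ[ℝ] → ℍ[ℝ] → ℝ) :
    ∑ k, ∫ q, g (q i) (q k) ∂ν =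
      ∫ q, g (q i) (q i) ∂ν + ((n : ℝ) - 1) * ∫ q, g (q i) (q j) ∂ν := by
  rw [← Finset.add_sum_erase _ _ (Finset.mem_univ i)]
  congr 1
  rw [Finset.sum_congr rfl fun k hk =>
    integral_swap_coord hperm hij (Finset.ne_of_mem_erase hk) g, Finset.sum_const, nsmul_eq_mul,
    Finset.card_erase_of_mem (Finset.mem_univ i), Finset.card_univ, Fintype.card_fin,
    Nat.cast_pred i.pos]

theorem mul_integral_norm_sq [IsProbabilityMeasure ν]
    (hperm : ∀ σ : Equiv.Perm (Fin n), MeasurePreserving (permCoord σ) ν ν)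
    (hν : ∀ᵐ q ∂ν, ∑ k, ‖q k‖ ^ 2 = 2) (i : Fin n) :
    (n : ℝ) * ∫ q, ‖q i‖ ^ 2 ∂ν = 2 := by
  have h : ∑ k, ∫ q, ‖q k‖ ^ 2 ∂ν = 2 := by
    rw [← integral_finsetSum, integral_congr_ae (g := fun _ => 2) hν]
    · simp
    · intro k _
      have ck := continuous_coord k
      exact integrable_of_continuous hν (by fun_prop)
  rw [Finset.sum_congr rfl fun k _ => integral_coord hperm i k fun x => ‖x‖ ^ 2] at h
  simpa using h

theorem integral_fourth_moment_add [IsProbabilityMeasure ν]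
    (hperm : ∀ σ : Equiv.Perm (Fin n), MeasurePreserving (permCoord σ) ν ν)
    (hν : ∀ᵐ q ∂ν, ∑ k, ‖q k‖ ^ 2 = 2) (hij : i ≠ j) :
    ∫ q, ‖q i‖ ^ 2 * ‖q i‖ ^ 2 ∂ν + ((n : ℝ) - 1) * ∫ q, ‖q i‖ ^ 2 * ‖q j‖ ^ 2 ∂ν = 4 / n := by
  have hn : (n : ℝ) ≠ 0 := Nat.cast_ne_zero.2 i.pos.ne'
  rw [← sum_integral_coord hperm hij fun x y => ‖x‖ ^ 2 * ‖y‖ ^ 2, ← integral_finsetSum]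
  · have h : (fun q : HSpace n => ∑ k, ‖q i‖ ^ 2 * ‖q k‖ ^ 2) =ᵐ[ν] fun q => ‖q i‖ ^ 2 * 2 := by
      filter_upwards [hν] with q hq
      rw [← Finset.mul_sum, hq]
    rw [integral_congr_ae h, integral_mul_const, eq_div_iff hn]
    linear_combination 2 * mul_integral_norm_sq hperm hν i
  · intro k _
    have ci := continuous_coord i
    have ck := continuous_coord k
    exact integrable_of_continuous hν (by fun_prop)

/-- Closedness makes `e_i` orthogonal to the sum of all edges, and `⟪e_i, e_i⟫ = ‖q i‖⁴`. -/
theorem integral_fourth_moment_add_edgeInner [IsFiniteMeasure ν]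
    (hperm : ∀ σ : Equiv.Perm (Fin n), MeasurePreserving (permCoord σ) ν ν)
    (hν : ∀ᵐ q ∂ν, IsClosedPreimage q) (hij : i ≠ j) :
    ∫ q, ‖q i‖ ^ 2 * ‖q i‖ ^ 2 ∂ν + ((n : ℝ) - 1) * ∫ q, edgeInnerLift i j q ∂ν = 0 := by
  have h := sum_integral_coord hperm hij fun x y => inner ℝ (hopf x) (hopf y)
  rw [← integral_finsetSum] at h
  · have h0 : (fun q : HSpace n => ∑ k, inner ℝ (hopf (q i)) (hopf (q k))) =ᵐ[ν] fun _ => 0 := by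
      filter_upwards [hν] with q hq
      rw [← inner_sum, hq.2, inner_zero_right]
    rw [integral_congr_ae h0, integral_zero] at h
    simp only [real_inner_self_eq_norm_mul_norm, norm_hopf] at h
    exact h.symm
  · intro k _
    exact integrable_of_continuous (hν.mono fun q hq => hq.1) (continuous_edgeInnerLift i k)

/-- Expanding `‖q i‖⁴ + ‖q j‖⁴` after the reflection gives half of itself plus `‖q i‖²‖q j‖² + 2⟪q
i, q j⟫²`; invariance of the integral yields the relation. -/
theorem integral_fourth_moment [IsFiniteMeasure ν]
    (hperm : ∀ σ : Equiv.Perm (Fin n), MeasurePreserving (permCoord σ) ν ν)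
    (hν : ∀ᵐ q ∂ν, ∑ k, ‖q k‖ ^ 2 = 2) (hij : i ≠ j)
    (hrefl : MeasurePreserving (reflect hij) ν ν) :
    ∫ q, ‖q i‖ ^ 2 * ‖q i‖ ^ 2 ∂ν =
      ∫ q, ‖q i‖ ^ 2 * ‖q j‖ ^ 2 ∂ν + 2 * ∫ q, inner ℝ (q i) (q j) ^ 2 ∂ν := by
  have ci := continuous_coord i
  have cj := continuous_coord j
  have Ii : Integrable (fun q : HSpace n => ‖q i‖ ^ 2 * ‖q i‖ ^ 2) ν :=
    integrable_of_continuous hν (by fun_prop)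
  have Ij : Integrable (fun q : HSpace n => ‖q j‖ ^ 2 * ‖q j‖ ^ 2) ν :=
    integrable_of_continuous hν (by fun_prop)
  have Iij : Integrable (fun q : HSpace n => ‖q i‖ ^ 2 * ‖q j‖ ^ 2) ν :=
    integrable_of_continuous hν (by fun_prop)
  have Ir : Integrable (fun q : HSpace n => inner ℝ (q i) (q j) ^ 2) ν :=
    integrable_of_continuous hν (by fun_prop)
  have hj := integral_coord hperm i j fun x => ‖x‖ ^ 2 * ‖x‖ ^ 2
  have h := integral_comp_isometry hrefl
    fun q => ‖q i‖ ^ 2 * ‖q i‖ ^ 2 + ‖q j‖ ^ 2 * ‖q j‖ ^ 2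
  have hpt : ∀ q : HSpace n, ‖reflect hij q i‖ ^ 2 * ‖reflect hij q i‖ ^ 2 +
      ‖reflect hij q j‖ ^ 2 * ‖reflect hij q j‖ ^ 2 =
      (1 / 2) * (‖q i‖ ^ 2 * ‖q i‖ ^ 2 + ‖q j‖ ^ 2 * ‖q j‖ ^ 2) +
        (‖q i‖ ^ 2 * ‖q j‖ ^ 2 + 2 * inner ℝ (q i) (q j) ^ 2) := by
    intro q
    simp only [reflect_apply, reflectCoord, if_true, if_neg hij.symm, norm_sq_smul_add,
      norm_sq_smul_sub]
    ring
  simp only [hpt] at h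
  rw [integral_add ((Ii.fun_add Ij).const_mul _) (Iij.fun_add (Ir.const_mul _)), integral_const_mul,
    integral_add Iij (Ir.const_mul _), integral_const_mul, integral_add Ii Ij, hj] at h
  linarith

theorem integral_inner_qi_mul_sq
    (hT : MeasurePreserving (leftMul (unitAt j qi) (norm_unitAt norm_qi j)) ν ν) (hij : i ≠ j) :
    ∫ q, inner ℝ (q i) (qi * q j) ^ 2 ∂ν = ∫ q, inner ℝ (q i) (q j) ^ 2 ∂ν := by
  simpa [unitAt, hij] using integral_comp_isometry hT fun q => inner ℝ (q i) (q j) ^ 2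

end Moments

/-! ### Solving the moment equations for closed polygons -/

theorem one_lt_of_ne {i j : Fin n} (hij : i ≠ j) : (1 : ℝ) < n := by
  have : Nontrivial (Fin n) := ⟨i, j, hij⟩
  exact_mod_cast Fin.nontrivial_iff_two_le.1 this

theorem integral_edgeInnerLift_complexStiefel {i j : Fin n} (hij : i ≠ j) :
    ∫ q, edgeInnerLift i j q ∂normalizedVol (4 * n - 4) (complexStiefel n) =
      -(6 / ((n : ℝ) ^ 3 - n)) := by
  obtain ⟨h0, htop⟩ := hausdorffMeasure_complexStiefel hij
  have hprob : IsProbabilityMeasure (normalizedVol (4 * n - 4) (complexStiefel n)) :=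
    ProbabilityTheory.cond_isProbabilityMeasure_of_finite h0 htop
  have hM := measurableSet_complexStiefel (n := n)
  set ν := normalizedVol (4 * n - 4) (complexStiefel n)
  have hν : ∀ᵐ q ∂ν, IsClosedPreimage q :=
    (ae_normalizedVol hM).mono fun q hq => (mem_complexStiefel_iff q).1 hq
  have hν' : ∀ᵐ q ∂ν, ∑ k, ‖q k‖ ^ 2 = 2 := hν.mono fun q hq => hq.1
  have hperm : ∀ σ : Equiv.Perm (Fin n), MeasurePreserving (permCoord σ) ν ν := fun σ =>
    measurePreserving_normalizedVol _ hM fun q => by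
      simp only [mem_complexStiefel_iff, isClosedPreimage_permCoord_iff]
  have hrefl : MeasurePreserving (reflect hij) ν ν :=
    measurePreserving_normalizedVol _ hM fun q => by
      simp only [mem_complexStiefel_iff, isClosedPreimage_reflect_iff]
  have hmul : MeasurePreserving (leftMul (unitAt j qi) (norm_unitAt norm_qi j)) ν ν :=
    measurePreserving_normalizedVol _ hM fun q => by
      simp only [mem_complexStiefel_iff, isClosedPreimage_leftMul_qi_iff]
  have e1 := integral_fourth_moment_add hperm hν' hij
  have e2 := integral_fourth_moment_add_edgeInner hperm hν hij
  have e3 := integral_fourth_moment hperm hν' hij hrefl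
  have e4 := integral_edgeInnerLift (i := i) (j := j) hν'
  rw [integral_inner_qi_mul_sq hmul hij] at e4
  have hn := one_lt_of_ne hij
  generalize ∫ q, edgeInnerLift i j q ∂ν = G at *
  generalize ∫ q, ‖q i‖ ^ 2 * ‖q i‖ ^ 2 ∂ν = X at *
  generalize ∫ q, ‖q i‖ ^ 2 * ‖q j‖ ^ 2 ∂ν = Y at *
  generalize ∫ q, inner ℝ (q i) (q j) ^ 2 ∂ν = R at *
  have hn0 : (n : ℝ) ≠ 0 := by positivity
  have hden : (n : ℝ) ^ 3 - n ≠ 0 := by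
    have h1 : (0 : ℝ) < n - 1 := sub_pos.2 hn
    have h2 : (n : ℝ) ^ 3 - n = n * ((n - 1) * (n + 1)) := by ring
    rw [h2]
    positivity
  rw [eq_div_iff hn0] at e1
  rw [← neg_div, eq_div_iff hden]
  -- `e4 - 2 * e3` eliminates `R` and leaves `G = 2X - 3Y`; `e1` and `e2` then eliminate `Y` and
  -- `X`.
  linear_combination (-3 / 2 : ℝ) * e1 + (n * (n + 1 / 2) : ℝ) * e2 +
    (n * (n - 1) / 2 : ℝ) * (e4 - 2 * e3)

theorem integral_edgeInnerLift_planarStiefel {i j : Fin n} (hij : i ≠ j) :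
    ∫ q, edgeInnerLift i j q ∂normalizedVol (2 * n - 3) (planarStiefel n) =
      -(8 / (((n : ℝ) - 1) * n * (n + 2))) := by
  obtain ⟨h0, htop⟩ := hausdorffMeasure_planarStiefel hij
  have hprob : IsProbabilityMeasure (normalizedVol (2 * n - 3) (planarStiefel n)) :=
    ProbabilityTheory.cond_isProbabilityMeasure_of_finite h0 htop
  have hM := measurableSet_planarStiefel (n := n)
  set ν := normalizedVol (2 * n - 3) (planarStiefel n)
  have hν : ∀ᵐ q ∂ν, IsClosedPreimage q :=
    (ae_normalizedVol hM).mono fun q hq => ((mem_planarStiefel_iff q).1 hq).1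
  have hν' : ∀ᵐ q ∂ν, ∑ k, ‖q k‖ ^ 2 = 2 := hν.mono fun q hq => hq.1
  have hperm : ∀ σ : Equiv.Perm (Fin n), MeasurePreserving (permCoord σ) ν ν := fun σ =>
    measurePreserving_normalizedVol _ hM fun q => by
      simp only [mem_planarStiefel_iff, isClosedPreimage_permCoord_iff, isPlanar_permCoord_iff]
  have hrefl : MeasurePreserving (reflect hij) ν ν :=
    measurePreserving_normalizedVol _ hM fun q => by
      simp only [mem_planarStiefel_iff, isClosedPreimage_reflect_iff,
        isPlanar_reflect_iff]
  -- Left multiplication by `i` exchanges the planes `ℝ ⊕ ℝj` and `ℝi ⊕ ℝk`, which are orthogonal.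
  have hplanar : ∫ q, inner ℝ (q i) (qi * q j) ^ 2 ∂ν = 0 := by
    refine integral_eq_zero_of_ae ((ae_normalizedVol hM).mono fun q hq => ?_)
    rcases ((mem_planarStiefel_iff q).1 hq).2 with h | h <;>
      simp [Quaternion.inner_def, h i, h j]
  have e1 := integral_fourth_moment_add hperm hν' hij
  have e2 := integral_fourth_moment_add_edgeInner hperm hν hij
  have e3 := integral_fourth_moment hperm hν' hij hrefl
  have e4 := integral_edgeInnerLift (i := i) (j := j) hν'
  rw [hplanar] at e4
  have hn := one_lt_of_ne hij
  generalize ∫ q, edgeInnerLift i j q ∂ν = G at *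
  generalize ∫ q, ‖q i‖ ^ 2 * ‖q i‖ ^ 2 ∂ν = X at *
  generalize ∫ q, ‖q i‖ ^ 2 * ‖q j‖ ^ 2 ∂ν = Y at *
  generalize ∫ q, inner ℝ (q i) (q j) ^ 2 ∂ν = R at *
  have hn0 : (n : ℝ) ≠ 0 := by positivity
  have hden : ((n : ℝ) - 1) * n * (n + 2) ≠ 0 := by
    have h1 : (0 : ℝ) < n - 1 := sub_pos.2 hn
    positivity
  rw [eq_div_iff hn0] at e1
  rw [← neg_div, eq_div_iff hden]
  -- Here `e4 - e3` eliminates `R`, leaving `G = X - 2Y`.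
  linear_combination (-2 : ℝ) * e1 + (n * (n + 1) : ℝ) * e2 + (n * (n - 1) : ℝ) * (e4 - e3)

end PolygonSpace

end

/-! ### The four expectations -/

theorem corollary7p3 (n : ℕ) (i j : Fin n) (hij : i ≠ j) :
    (Integrable (PolygonSpace.edgeInner (PolygonSpace.Arm3 n) i j) (PolygonSpace.symArm3 n) ∧
      ∫ P, PolygonSpace.edgeInner (PolygonSpace.Arm3 n) i j P ∂(PolygonSpace.symArm3 n) = 0) ∧
    (Integrable (PolygonSpace.edgeInner (PolygonSpace.Pol3 n) i j) (PolygonSpace.symPol3 n) ∧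
      ∫ P, PolygonSpace.edgeInner (PolygonSpace.Pol3 n) i j P ∂(PolygonSpace.symPol3 n) =
        -(6 / ((n : ℝ) ^ 3 - n))) ∧
    (Integrable (PolygonSpace.edgeInner (PolygonSpace.Arm2 n) i j) (PolygonSpace.symArm2 n) ∧
      ∫ P, PolygonSpace.edgeInner (PolygonSpace.Arm2 n) i j P ∂(PolygonSpace.symArm2 n) = 0) ∧
    (Integrable (PolygonSpace.edgeInner (PolygonSpace.Pol2 n) i j) (PolygonSpace.symPol2 n) ∧
      ∫ P, PolygonSpace.edgeInner (PolygonSpace.Pol2 n) i j P ∂(PolygonSpace.symPol2 n) =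
        -(8 / (((n : ℝ) - 1) * n * (n + 2)))) := by
  refine ⟨?_, ?_, ?_, ?_⟩
  · obtain ⟨hint, heq⟩ := PolygonSpace.integrable_integral_symMeasure (d := 4 * n - 1)
      PolygonSpace.measurableSet_quatSphere PolygonSpace.measurableSet_Arm3
      (fun q hq => ⟨(PolygonSpace.mem_quatSphere_iff q).1 hq,
        PolygonSpace.hopfMap_mem_Arm3 ((PolygonSpace.mem_quatSphere_iff q).1 hq)⟩) i j
    refine ⟨hint, heq.trans (PolygonSpace.integral_edgeInnerLift_eq_zero hij ?_)⟩
    refine PolygonSpace.measurePreserving_normalizedVol _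
      PolygonSpace.measurableSet_quatSphere fun q => ?_
    simp [PolygonSpace.mem_quatSphere_iff, PolygonSpace.norm_unitAt PolygonSpace.norm_qj]
  · obtain ⟨hint, heq⟩ := PolygonSpace.integrable_integral_symMeasure (d := 4 * n - 4)
      PolygonSpace.measurableSet_complexStiefel PolygonSpace.measurableSet_Pol3
      (fun q hq => by
        obtain ⟨h1, h2⟩ := (PolygonSpace.mem_complexStiefel_iff q).1 hq
        exact ⟨h1, PolygonSpace.hopfMap_mem_Arm3 h1, h2⟩) i j
    exact ⟨hint, heq.trans (PolygonSpace.integral_edgeInnerLift_complexStiefel hij)⟩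
  · obtain ⟨hint, heq⟩ := PolygonSpace.integrable_integral_symMeasure (d := 2 * n - 1)
      PolygonSpace.measurableSet_planarSpheres PolygonSpace.measurableSet_Arm2
      (fun q hq => by
        obtain ⟨h1, h2⟩ := (PolygonSpace.mem_planarSpheres_iff q).1 hq
        exact ⟨h1, PolygonSpace.hopfMap_mem_Arm2 h1 h2⟩) i j
    refine ⟨hint, heq.trans (PolygonSpace.integral_edgeInnerLift_eq_zero hij ?_)⟩
    refine PolygonSpace.measurePreserving_normalizedVol _
      PolygonSpace.measurableSet_planarSpheres fun q => ?_
    simp only [PolygonSpace.mem_planarSpheres_iff, PolygonSpace.isPlanar_leftMul_qj_iff]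
    simp [PolygonSpace.norm_unitAt PolygonSpace.norm_qj]
  · obtain ⟨hint, heq⟩ := PolygonSpace.integrable_integral_symMeasure (d := 2 * n - 3)
      PolygonSpace.measurableSet_planarStiefel PolygonSpace.measurableSet_Pol2
      (fun q hq => by
        obtain ⟨⟨h1, h2⟩, h3⟩ := (PolygonSpace.mem_planarStiefel_iff q).1 hq
        exact ⟨h1, PolygonSpace.hopfMap_mem_Arm2 h1 h3, h2⟩) i j
    exact ⟨hint, heq.trans (PolygonSpace.integral_edgeInnerLift_planarStiefel hij)⟩
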